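/- Let $n\ge 1$, and let $\Sigma^n\subseteq\mathbb{R}^{n+1}$ be a compact $e_{n+1}$-directed self-translater with boundary $\partial\Sigma\neq\emptyset$: that is, a smooth immersed hypersurface with boundary (the image of a compact smooth $n$-manifold with boundary under a smooth immersion, not assumed connected, $\partial\Sigma$ being the image of the manifold boundary) whose mean curvature vector satisfies $\boldsymbol{H}=\langle e_{n+1},\nu\rangle\,\nu$, where $\nu$ is a unit normal and $\boldsymbol{H}$ is the trace of the vector-valued second fundamental form with respect to the induced metric. Let $\pi\colon\mathbb{R}^{n+1}\to\mathbb{R}^n$, $\pi(x_1,\dots,x_n,x_{n+1})=(x_1,\dots,x_n)$, be the standard orthogonal projection. Then $$\Sigma\subseteq \operatorname{conv}\bigl(\pi(\partial\Sigma)\bigr)\times\bigl(-\infty,\ \max_{\partial\Sigma}x_{n+1}\bigr],$$ where $\operatorname{conv}(\pi(\partial\Sigma))$ is the convex hull of $\pi(\partial\Sigma)$ in $\mathbb{R}^n$ and the maximum of the coordinate $x_{n+1}$ over $\partial\Sigma$ is attained. -/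

import Mathlib

open Set Filter Topology
open scoped ContDiff Manifold

namespace SelfTranslater

/-- Euclidean space `ℝᵏ` with its standard inner product. -/
abbrev Euc (k : ℕ) : Type := EuclideanSpace ℝ (Fin k)

/-- The translation direction `e_{n+1}`, the last standard basis vector of `ℝⁿ⁺¹`. -/
noncomputable def eLast (n : ℕ) : Euc (n + 1) := EuclideanSpace.single (Fin.last n) 1

/-- The last coordinate `x_{n+1}` of a point of `ℝⁿ⁺¹`. -/
def height {n : ℕ} (x : Euc (n + 1)) : ℝ := x (Fin.last n)

/-- The orthogonal projection `π(x_1, …, x_{n+1}) = (x_1, …, x_n)`. -/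
noncomputable def proj {n : ℕ} (x : Euc (n + 1)) : Euc n :=
  WithLp.toLp 2 fun i => x i.castSucc

section Curvature

variable {n : ℕ} [NeZero n] {M : Type*} [TopologicalSpace M]
  [ChartedSpace (EuclideanHalfSpace n) M]

/-- The map `F` read in the chart of the manifold with boundary `M` around `p`. It is only
relevant on the half-space `range (𝓡∂ n)`, near the point `extChartAt (𝓡∂ n) p p`. -/
noncomputable def inChart (F : M → Euc (n + 1)) (p : M) : Euc n → Euc (n + 1) :=
  F ∘ (extChartAt (𝓡∂ n) p).symm

/-- The partial derivative `∂ᵢ f (y)` of a map on the closed half-space of `ℝⁿ`. At an interior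
point it is the usual partial derivative. -/
noncomputable def partialDeriv (i : Fin n) (f : Euc n → Euc (n + 1)) (y : Euc n) : Euc (n + 1) :=
  fderivWithin ℝ f (range (𝓡∂ n)) y (EuclideanSpace.single i 1)

/-- The coordinate tangent vector `∂ᵢF` at `p`. -/
noncomputable def tangentVec (F : M → Euc (n + 1)) (p : M) (i : Fin n) : Euc (n + 1) :=
  partialDeriv i (inChart F p) (extChartAt (𝓡∂ n) p p)

/-- The second derivative `∂ᵢ∂ⱼF` at `p`. -/
noncomputable def secondDeriv (F : M → Euc (n + 1)) (p : M) (i j : Fin n) : Euc (n + 1) :=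
  partialDeriv i (partialDeriv j (inChart F p)) (extChartAt (𝓡∂ n) p p)

/-- The tangent space of the immersed hypersurface at `p`, as a subspace of `ℝⁿ⁺¹`. -/
noncomputable def tangentPlane (F : M → Euc (n + 1)) (p : M) : Submodule ℝ (Euc (n + 1)) :=
  Submodule.span ℝ (range (tangentVec F p))

/-- `ν` is one of the two unit normal vectors of the immersed hypersurface at `p`. -/
def IsUnitNormal (F : M → Euc (n + 1)) (p : M) (ν : Euc (n + 1)) : Prop :=
  ‖ν‖ = 1 ∧ ν ∈ (tangentPlane F p)ᗮ

/-- The induced metric (first fundamental form) `gᵢⱼ = ⟨∂ᵢF, ∂ⱼF⟩` at `p`. -/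
noncomputable def inducedMetric (F : M → Euc (n + 1)) (p : M) : Matrix (Fin n) (Fin n) ℝ :=
  Matrix.of fun i j => inner ℝ (tangentVec F p i) (tangentVec F p j)

/-- The vector-valued second fundamental form `Aᵢⱼ = (∂ᵢ∂ⱼF)^⊥` at `p`. -/
noncomputable def secondFundamentalForm (F : M → Euc (n + 1)) (p : M) (i j : Fin n) :
    Euc (n + 1) :=
  (tangentPlane F p)ᗮ.starProjection (secondDeriv F p i j)

/-- The mean curvature vector `𝐇 = tr_g A = ∑ᵢⱼ gⁱʲ Aᵢⱼ` at `p`, where `gⁱʲ` is the inverse of the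
induced metric. For an immersion it does not depend on the chart. -/
noncomputable def meanCurvatureVector (F : M → Euc (n + 1)) (p : M) : Euc (n + 1) :=
  ∑ i, ∑ j, (inducedMetric F p)⁻¹ i j • secondFundamentalForm F p i j

end Curvature

/-- `F : M → ℝⁿ⁺¹` is an `e_{n+1}`-directed (unit speed) self-translating hypersurface: a smooth
immersion of the `n`-manifold with boundary `M` with `𝐇 = ⟨e_{n+1}, ν⟩ ν`. The right-hand side
is the same for both unit normals `ν`, so no orientation is needed. -/
structure IsSelfTranslater {n : ℕ} [NeZero n] {M : Type*} [TopologicalSpace M]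
    [ChartedSpace (EuclideanHalfSpace n) M] (F : M → Euc (n + 1)) : Prop where
  smooth : ContMDiff (𝓡∂ n) 𝓘(ℝ, Euc (n + 1)) ∞ F
  immersion : ∀ p : M, Function.Injective (mfderiv (𝓡∂ n) 𝓘(ℝ, Euc (n + 1)) F p)
  equation : ∀ (p : M) (ν : Euc (n + 1)), IsUnitNormal F p ν →
    meanCurvatureVector F p = inner ℝ (eLast n) ν • ν

end SelfTranslater

/-!
The proof is the maximum principle for linear functions on a self-translater. Put
`L u = Δ u + ⟨e_{n+1}, ∇u⟩`. Since `Δ F = 𝐇 = e_{n+1}^⊥`, a linear function `⟨w, F⟩` satisfies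
`L ⟨w, F⟩ = ⟨e_{n+1}, w⟩`; it is therefore a strict subsolution when `⟨e_{n+1}, w⟩ > 0`, and has no
interior maximum (`IsSelfTranslater.not_isLocalMax_inner`). Strictness makes the elementary form of
the maximum principle sufficient, and only its content at a critical point is needed: there `w` is
normal to the hypersurface, so `⟨w, 𝐇⟩ = ⟨e_{n+1}, w⟩ > 0`, while `⟨w, 𝐇⟩` is the trace of the
negative semidefinite Hessian of `⟨w, F⟩` against the inverse metric, hence nonpositive.

With `w = e_{n+1}` this bounds the height by its maximum over the boundary. A horizontal `w` is
only a solution of `L u = 0`, and is treated as the limit of `w + ε e_{n+1}` as `ε → 0`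
(`IsSelfTranslater.inner_proj_le`); so every closed half-space of `ℝⁿ` that contains the projected
boundary contains the whole projection. The convex hull of the projected boundary is compact
(`IsCompact.convexHull_of_finiteDimensional`), hence the intersection of the closed half-spaces
containing it, and the claim follows.
-/

/-! ### Convex hulls of compact sets -/

/-- The convex hull of a compact subset of a finite-dimensional space is compact. By Carathéodory's
theorem it is the union, over `k ≤ dim E + 1`, of the images of the compact sets
`stdSimplex ℝ (Fin k) × sᵏ` under the map `(w, z) ↦ ∑ i, w i • z i`. -/
theorem IsCompact.convexHull_of_finiteDimensional {E : Type*} [NormedAddCommGroup E]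
    [NormedSpace ℝ E] [FiniteDimensional ℝ E] {s : Set E} (hs : IsCompact s) :
    IsCompact (convexHull ℝ s) := by
  have key : convexHull ℝ s = ⋃ k ∈ Finset.range (Module.finrank ℝ E + 2),
      (fun q : (Fin k → ℝ) × (Fin k → E) => ∑ i, q.1 i • q.2 i) ''
        (stdSimplex ℝ (Fin k) ×ˢ Set.univ.pi fun _ => s) := by
    apply Set.Subset.antisymm
    · intro x hx
      obtain ⟨ι, _, z, w, hz, hind, hw, hw1, rfl⟩ := eq_pos_convex_span_of_mem_convexHull hx
      have hcard := hind.card_le_finrank_succ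
      have hfin : Module.finrank ℝ (vectorSpan ℝ (Set.range z)) ≤ Module.finrank ℝ E :=
        Submodule.finrank_le _
      let e := (Fintype.equivFin ι).symm
      refine Set.mem_biUnion (x := Fintype.card ι) (by simp; omega)
        ⟨(w ∘ e, z ∘ e), ⟨⟨fun i => (hw _).le, ?_⟩, fun i _ => hz ⟨_, rfl⟩⟩, ?_⟩
      · rw [← hw1]
        exact e.sum_comp w
      · exact e.sum_comp fun i => w i • z i
    · refine Set.iUnion₂_subset fun k _ => ?_
      rintro _ ⟨⟨w, z⟩, ⟨hw, hz⟩, rfl⟩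
      exact (convex_convexHull ℝ s).sum_mem (fun i _ => hw.1 i) hw.2
        fun i _ => subset_convexHull ℝ s (hz i (Set.mem_univ i))
  rw [key]
  refine Finset.isCompact_biUnion _ fun k _ => ?_
  exact ((isCompact_stdSimplex ℝ (Fin k)).prod (isCompact_univ_pi fun _ => hs)).image (by fun_prop)

/-! ### Second-order conditions at a maximum -/

/-- The second-order necessary condition at a maximum. A positive second derivative would make `t`
a local minimum as well, so that `φ` would be constant near `t`. -/
theorem IsLocalMax.deriv_deriv_nonpos {φ : ℝ → ℝ} {t : ℝ} (h : IsLocalMax φ t)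
    (hc : ContinuousAt φ t) : deriv (deriv φ) t ≤ 0 := by
  by_contra! hpos
  have hmin := isLocalMin_of_deriv_deriv_pos hpos h.deriv_eq_zero hc
  have hconst : φ =ᶠ[𝓝 t] fun _ => φ t := by
    filter_upwards [h, hmin] with s h₁ h₂ using le_antisymm h₁ h₂
  rw [hconst.deriv.deriv_eq] at hpos
  simp at hpos

/-- At a local maximum the Hessian is negative semidefinite. -/
theorem IsLocalMax.fderiv_fderiv_apply_nonpos {E : Type*} [NormedAddCommGroup E]
    [NormedSpace ℝ E] {f : E → ℝ} {x : E} (h : IsLocalMax f x) (hf : ContDiffAt ℝ 2 f x) (b : E) :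
    fderiv ℝ (fderiv ℝ f) x b b ≤ 0 := by
  have hline (t : ℝ) : HasDerivAt (fun t : ℝ => x + t • b) b t := by
    simpa using ((hasDerivAt_id t).smul_const b).const_add x
  have htend : Tendsto (fun t : ℝ => x + t • b) (𝓝 0) (𝓝 x) := by
    simpa using (hline 0).continuousAt.tendsto
  have hmax : IsLocalMax (fun t : ℝ => f (x + t • b)) 0 := by
    have := htend.eventually h
    simpa [IsLocalMax, IsMaxFilter] using this
  have hdiff : ∀ᶠ y in 𝓝 x, DifferentiableAt ℝ f y := by
    filter_upwards [hf.eventually (by simp)] with y hy using hy.differentiableAt (by simp)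
  have h₁ : deriv (fun t : ℝ => f (x + t • b)) =ᶠ[𝓝 0] fun t => fderiv ℝ f (x + t • b) b := by
    filter_upwards [htend.eventually hdiff] with t ht
    exact (ht.hasFDerivAt.comp_hasDerivAt t (hline t)).deriv
  have hd : DifferentiableAt ℝ (fderiv ℝ f) x :=
    (hf.fderiv_right (m := 1) (by norm_num)).differentiableAt (by simp)
  have hcomp : HasDerivAt (fun t : ℝ => fderiv ℝ f (x + t • b)) (fderiv ℝ (fderiv ℝ f) x b) 0 :=
    hd.hasFDerivAt.comp_hasDerivAt_of_eq 0 (hline 0) (by simp)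
  have h₂ : deriv (fun t : ℝ => fderiv ℝ f (x + t • b) b) 0 = fderiv ℝ (fderiv ℝ f) x b b := by
    have := (hcomp.clm_apply (hasDerivAt_const (0 : ℝ) b)).deriv
    rw [map_zero, add_zero] at this
    exact this
  rw [← h₂, ← h₁.deriv_eq]
  refine hmax.deriv_deriv_nonpos (ContinuousAt.comp (g := f) ?_ (hline 0).continuousAt)
  simpa using hf.continuousAt

/-- The trace pairing of a positive semidefinite matrix with a negative semidefinite form is
nonpositive. -/
theorem Matrix.PosSemidef.sum_mul_apply_nonpos {ι E : Type*} [Fintype ι]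
    [NormedAddCommGroup E] [NormedSpace ℝ E] {G : Matrix ι ι ℝ} (hG : G.PosSemidef)
    {B : E →L[ℝ] E →L[ℝ] ℝ} (hB : ∀ b, B b b ≤ 0) (v : ι → E) :
    ∑ i, ∑ j, G i j * B (v i) (v j) ≤ 0 := by
  obtain ⟨m, a, rfl⟩ := Matrix.posSemidef_iff_eq_sum_vecMulVec.1 hG
  have key : ∑ i, ∑ j, (∑ k, Matrix.vecMulVec (a k) (star (a k))) i j * B (v i) (v j) =
      ∑ k, B (∑ i, a k i • v i) (∑ i, a k i • v i) := by
    simp only [Matrix.sum_apply, Matrix.vecMulVec_apply, star_trivial,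
      map_sum, map_smul, _root_.sum_apply, _root_.smul_apply,
      smul_eq_mul, Finset.sum_mul, Finset.mul_sum]
    rw [Finset.sum_congr rfl fun i _ => Finset.sum_comm, Finset.sum_comm]
    refine Finset.sum_congr rfl fun k _ => ?_
    rw [Finset.sum_comm]
    refine Finset.sum_congr rfl fun i _ => Finset.sum_congr rfl fun j _ => ?_
    ring
  rw [key]
  exact Finset.sum_nonpos fun k _ => hB _

namespace SelfTranslater

/-! ### Height, projection and horizontal vectors -/

section Coordinates

variable {n : ℕ}

theorem height_eq_inner (x : Euc (n + 1)) : height x = inner ℝ (eLast n) x := by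
  simp [height, eLast, EuclideanSpace.inner_single_left]

theorem continuous_height : Continuous (height (n := n)) := by
  unfold height
  fun_prop

theorem continuous_proj : Continuous (proj (n := n)) := by
  unfold proj
  fun_prop

/-- The horizontal vector `(v, 0)` of `ℝⁿ⁺¹`. -/
noncomputable def horizontalLift (v : Euc n) : Euc (n + 1) :=
  WithLp.toLp 2 (Fin.snoc v.ofLp 0)

theorem inner_horizontalLift (v : Euc n) (x : Euc (n + 1)) :
    inner ℝ (horizontalLift v) x = inner ℝ v (proj x) := by
  simp [horizontalLift, proj, PiLp.inner_apply, Fin.sum_univ_castSucc]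

end Coordinates

/-! ### Interior maxima of linear functions -/

section Interior

variable {n : ℕ} [NeZero n] {M : Type*} [TopologicalSpace M]
  [ChartedSpace (EuclideanHalfSpace n) M]

theorem partialDeriv_eventuallyEq {y : Euc n} (hy : range (𝓡∂ n) ∈ 𝓝 y) (i : Fin n)
    (f : Euc n → Euc (n + 1)) :
    partialDeriv i f =ᶠ[𝓝 y] fun z => fderiv ℝ f z (EuclideanSpace.single i 1) := by
  filter_upwards [eventually_mem_nhds_iff.2 hy] with z hz
  rw [partialDeriv, fderivWithin_of_mem_nhds hz]

/-- Smoothness on the half-space becomes genuine differentiability at an interior point. Order two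
is all that the Hessian requires. -/
theorem contDiffAt_inChart {F : M → Euc (n + 1)} (hF : ContMDiff (𝓡∂ n) 𝓘(ℝ, Euc (n + 1)) ∞ F)
    {p : M} (hp : (𝓡∂ n).IsInteriorPoint p) :
    ContDiffAt ℝ 2 (inChart F p) (extChartAt (𝓡∂ n) p p) :=
  have h : ContDiffAt ℝ ∞ (inChart F p) (extChartAt (𝓡∂ n) p p) :=
    (contMDiffAt_iff.1 (hF p)).2.contDiffAt (range_mem_nhds_isInteriorPoint hp)
  h.of_le ENat.LEInfty.out

theorem inner_tangentVec {F : M → Euc (n + 1)}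
    (hF : ContMDiff (𝓡∂ n) 𝓘(ℝ, Euc (n + 1)) ∞ F) {p : M} (hp : (𝓡∂ n).IsInteriorPoint p)
    (w : Euc (n + 1)) (i : Fin n) :
    inner ℝ w (tangentVec F p i) = fderiv ℝ (fun z => inner ℝ w (inChart F p z))
      (extChartAt (𝓡∂ n) p p) (EuclideanSpace.single i 1) := by
  have hd := (contDiffAt_inChart hF hp).differentiableAt (by simp)
  have h := ((innerSL ℝ w).hasFDerivAt.comp _ hd.hasFDerivAt).fderiv
  rw [tangentVec, (partialDeriv_eventuallyEq (range_mem_nhds_isInteriorPoint hp) i _).eq_of_nhds]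
  exact (DFunLike.congr_fun h (EuclideanSpace.single i 1)).symm

theorem inner_secondDeriv {F : M → Euc (n + 1)}
    (hF : ContMDiff (𝓡∂ n) 𝓘(ℝ, Euc (n + 1)) ∞ F) {p : M} (hp : (𝓡∂ n).IsInteriorPoint p)
    (w : Euc (n + 1)) (i j : Fin n) :
    inner ℝ w (secondDeriv F p i j) =
      fderiv ℝ (fderiv ℝ fun z => inner ℝ w (inChart F p z)) (extChartAt (𝓡∂ n) p p)
        (EuclideanSpace.single i 1) (EuclideanSpace.single j 1) := by
  have hf := contDiffAt_inChart hF hp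
  have hrange := range_mem_nhds_isInteriorPoint hp
  set y := extChartAt (𝓡∂ n) p p
  set f := inChart F p
  have hd : DifferentiableAt ℝ (fderiv ℝ f) y :=
    (hf.fderiv_right (m := 1) (by norm_num)).differentiableAt (by simp)
  have hcomp : (fderiv ℝ fun z => inner ℝ w (f z)) =ᶠ[𝓝 y]
      fun z => (innerSL ℝ w).comp (fderiv ℝ f z) := by
    filter_upwards [hf.eventually (by simp)] with z hz
    exact ((innerSL ℝ w).hasFDerivAt.comp z (hz.differentiableAt (by simp)).hasFDerivAt).fderiv
  have hleft : secondDeriv F p i j =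
      fderiv ℝ (fderiv ℝ f) y (EuclideanSpace.single i 1) (EuclideanSpace.single j 1) := by
    change partialDeriv i (partialDeriv j f) y = _
    rw [(partialDeriv_eventuallyEq hrange i _).eq_of_nhds,
      (partialDeriv_eventuallyEq hrange j f).fderiv_eq,
      (hd.hasFDerivAt.clm_apply (hasFDerivAt_const _ y)).fderiv]
    simp
  have hright := hcomp.fderiv_eq.trans
    ((hasFDerivAt_const (innerSL ℝ w) y).clm_comp hd.hasFDerivAt).fderiv
  rw [hleft, hright]
  simp

/-- The scalar `⟨w, 𝐇⟩` at a normal vector `w` is the trace of the coordinate Hessian of the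
function `⟨w, F⟩`. -/
theorem inner_meanCurvatureVector_of_mem_orthogonal (F : M → Euc (n + 1)) (p : M)
    {w : Euc (n + 1)} (hw : w ∈ (tangentPlane F p)ᗮ) :
    inner ℝ w (meanCurvatureVector F p) =
      ∑ i, ∑ j, (inducedMetric F p)⁻¹ i j * inner ℝ w (secondDeriv F p i j) := by
  simp only [meanCurvatureVector, inner_sum, inner_smul_right]
  refine Finset.sum_congr rfl fun i _ => Finset.sum_congr rfl fun j _ => ?_
  rw [secondFundamentalForm, ← Submodule.inner_starProjection_left_eq_right,
    Submodule.starProjection_eq_self_iff.2 hw]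

/-- The linear functions that strictly increase in the translation direction have no interior
maximum on a self-translater. At such a maximum `w` would be normal, so that
`⟨w, 𝐇⟩ = ⟨e_{n+1}, w⟩ > 0`, whereas the Hessian of `⟨w, F⟩` is negative semidefinite. -/
theorem IsSelfTranslater.not_isLocalMax_inner {F : M → Euc (n + 1)} (hF : IsSelfTranslater F)
    {w : Euc (n + 1)} (hw : 0 < inner ℝ (eLast n) w) {p : M} (hp : (𝓡∂ n).IsInteriorPoint p) :
    ¬ IsLocalMax (fun q => inner ℝ w (F q)) p := by
  intro hmax
  have hf := contDiffAt_inChart hF.smooth hp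
  have hmax' : IsLocalMax (fun z => inner ℝ w (inChart F p z)) (extChartAt (𝓡∂ n) p p) := by
    have hsymm : Tendsto (extChartAt (𝓡∂ n) p).symm (𝓝 (extChartAt (𝓡∂ n) p p)) (𝓝 p) := by
      simpa only [ContinuousAt, extChartAt_to_inv] using
        continuousAt_extChartAt_symm (I := 𝓡∂ n) p
    filter_upwards [hsymm.eventually hmax] with z hz
    simpa only [inChart, Function.comp_apply, extChartAt_to_inv] using hz
  have hnormal : w ∈ (tangentPlane F p)ᗮ := by
    rw [tangentPlane, Submodule.mem_orthogonal']
    intro u hu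
    induction hu using Submodule.span_induction with
    | mem u hu =>
      obtain ⟨i, rfl⟩ := hu
      rw [inner_tangentVec hF.smooth hp, hmax'.fderiv_eq_zero]
      rfl
    | zero => simp
    | add a b _ _ ha hb => rw [inner_add_right, ha, hb, add_zero]
    | smul c a _ ha => rw [inner_smul_right, ha, mul_zero]
  have hw0 : w ≠ 0 := by
    rintro rfl
    simp at hw
  have hunit : IsUnitNormal F p (‖w‖⁻¹ • w) :=
    ⟨norm_smul_inv_norm hw0, Submodule.smul_mem _ _ hnormal⟩
  have hpos : inner ℝ w (meanCurvatureVector F p) = inner ℝ (eLast n) w := by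
    rw [hF.equation p _ hunit]
    simp only [inner_smul_right, real_inner_self_eq_norm_sq]
    field_simp [norm_ne_zero_iff.2 hw0]
  have hneg : inner ℝ w (meanCurvatureVector F p) ≤ 0 := by
    rw [inner_meanCurvatureVector_of_mem_orthogonal F p hnormal]
    simp only [inner_secondDeriv hF.smooth hp]
    have hG : (inducedMetric F p).PosSemidef := Matrix.posSemidef_gram ℝ (tangentVec F p)
    have hu : ContDiffAt ℝ 2 (fun z => inner ℝ w (inChart F p z)) (extChartAt (𝓡∂ n) p p) :=
      contDiffAt_const.inner ℝ hf
    exact hG.inv.sum_mul_apply_nonpos (hmax'.fderiv_fderiv_apply_nonpos hu) _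
  linarith

end Interior

/-! ### The maximum principle on a compact self-translater -/

section Compact

variable {n : ℕ} [NeZero n] {M : Type*} [TopologicalSpace M] [CompactSpace M]
  [ChartedSpace (EuclideanHalfSpace n) M]

theorem IsSelfTranslater.exists_boundary_isMaxOn_inner [Nonempty M] {F : M → Euc (n + 1)}
    (hF : IsSelfTranslater F) {w : Euc (n + 1)} (hw : 0 < inner ℝ (eLast n) w) :
    ∃ q ∈ (𝓡∂ n).boundary M, ∀ p, inner ℝ w (F p) ≤ inner ℝ w (F q) := by
  have hcont : Continuous fun q => inner ℝ w (F q) :=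
    continuous_const.inner hF.smooth.continuous
  obtain ⟨q, -, hq⟩ := isCompact_univ.exists_isMaxOn univ_nonempty hcont.continuousOn
  refine ⟨q, ?_, fun p => hq (mem_univ p)⟩
  rcases (𝓡∂ n).isInteriorPoint_or_isBoundaryPoint q with hint | hbd
  · exact absurd (hq.isLocalMax univ_mem) (hF.not_isLocalMax_inner hw hint)
  · exact hbd

/-- A horizontal linear function is bounded by its values on the boundary. It does not itself
increase in the translation direction, so the maximum principle is applied to `⟨v, π F⟩ + ε x_{n+1}`
with a small `ε > 0`. -/
theorem IsSelfTranslater.inner_proj_le {F : M → Euc (n + 1)} (hF : IsSelfTranslater F)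
    {v : Euc n} {c : ℝ} (hc : ∀ q ∈ (𝓡∂ n).boundary M, inner ℝ v (proj (F q)) ≤ c) (p : M) :
    inner ℝ v (proj (F p)) ≤ c := by
  have : Nonempty M := ⟨p⟩
  obtain ⟨C, hC⟩ : ∃ C, ∀ q, height (F q) ≤ C := by
    obtain ⟨C, hC⟩ := (isCompact_range (continuous_height.comp hF.smooth.continuous)).bddAbove
    exact ⟨C, fun q => hC ⟨q, rfl⟩⟩
  refine le_of_forall_pos_lt_add fun δ hδ => ?_
  -- With this `ε` the perturbation exceeds its value at `p` by at most
  -- `ε (C - x_{n+1}(F p)) < δ`.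
  set K := C - height (F p)
  have hK : 0 ≤ K := sub_nonneg.2 (hC p)
  set ε := δ / (K + 1)
  have hε : 0 < ε := by positivity
  have hinner (x : Euc (n + 1)) : inner ℝ (horizontalLift v + ε • eLast n) x =
      inner ℝ v (proj x) + ε * height x := by
    rw [inner_add_left, inner_smul_left, inner_horizontalLift, height_eq_inner]
    simp
  have hw : 0 < inner ℝ (eLast n) (horizontalLift v + ε • eLast n) := by
    rw [real_inner_comm, hinner]
    have h₁ : proj (eLast n) = 0 := by
      ext i
      simp [proj, eLast, Fin.castSucc_ne_last]
    have h₂ : height (eLast n) = 1 := by simp [height, eLast]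
    rwa [h₁, h₂, inner_zero_right, zero_add, mul_one]
  obtain ⟨q, hq, hmax⟩ := hF.exists_boundary_isMaxOn_inner hw
  have h := hmax p
  rw [hinner, hinner] at h
  have h₁ : ε * height (F q) ≤ ε * C := mul_le_mul_of_nonneg_left (hC q) hε.le
  have h₂ : ε * K < δ := by
    rw [div_mul_eq_mul_div, div_lt_iff₀ (by positivity)]
    nlinarith
  have h₃ : ε * K = ε * C - ε * height (F p) := mul_sub _ _ _
  linarith [hc q hq]

end Compact

end SelfTranslater

/-! ### The convex hull property -/

theorem mainTheorem6 (n : ℕ) [NeZero n] (M : Type*) [TopologicalSpace M] [T2Space M]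
    [CompactSpace M] [ChartedSpace (EuclideanHalfSpace n) M] [IsManifold (𝓡∂ n) ∞ M]
    (F : M → SelfTranslater.Euc (n + 1)) (hF : SelfTranslater.IsSelfTranslater F)
    (hbd : ((𝓡∂ n).boundary M).Nonempty) :
    ∃ m : ℝ, IsGreatest (SelfTranslater.height '' (F '' (𝓡∂ n).boundary M)) m ∧
      (fun x => (SelfTranslater.proj x, SelfTranslater.height x)) '' range F ⊆
        convexHull ℝ (SelfTranslater.proj '' (F '' (𝓡∂ n).boundary M)) ×ˢ Iic m := by
  have hcont := hF.smooth.continuous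
  have : Nonempty M := hbd.to_type
  have hcompact : IsCompact ((𝓡∂ n).boundary M) :=
    ((𝓡∂ n).isClosed_boundary (n := ∞) (by simp)).isCompact
  obtain ⟨q, hq, hmax⟩ := hF.exists_boundary_isMaxOn_inner (w := SelfTranslater.eLast n)
    (by simp [SelfTranslater.eLast])
  simp only [← SelfTranslater.height_eq_inner] at hmax
  refine ⟨SelfTranslater.height (F q), ⟨⟨F q, ⟨q, hq, rfl⟩, rfl⟩, ?_⟩, ?_⟩
  · rintro _ ⟨_, ⟨p, -, rfl⟩, rfl⟩
    exact hmax p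
  rintro _ ⟨_, ⟨p, rfl⟩, rfl⟩
  refine ⟨?_, hmax p⟩
  by_contra hp
  have hclosed := ((hcompact.image hcont).image
    SelfTranslater.continuous_proj).convexHull_of_finiteDimensional.isClosed
  obtain ⟨f, c, hfc, hcp⟩ := geometric_hahn_banach_closed_point (convex_convexHull ℝ _) hclosed hp
  set v := (InnerProductSpace.toDual ℝ (SelfTranslater.Euc n)).symm f
  have hv (x : SelfTranslater.Euc n) : inner ℝ v x = f x :=
    InnerProductSpace.toDual_symm_apply
  refine absurd (hF.inner_proj_le (v := v) (c := c) (fun r hr => ?_) p) ?_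
  · rw [hv]
    exact (hfc _ (subset_convexHull ℝ _ ⟨_, ⟨r, hr, rfl⟩, rfl⟩)).le
  · rw [hv]
    exact hcp.not_ge
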